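/- Let $G$ be a group, let $\varphi : G \to G^{\varphi}$, $g \mapsto g^{\varphi}$, be an isomorphism onto a copy of $G$, and let $$\chi(G) = \langle G \cup G^{\varphi} \mid [g,g^{\varphi}]=1 \text{ for all } g \in G \rangle ,$$ that is, the quotient of the free product $G * G^{\varphi}$ by the normal closure of the elements $[g,g^{\varphi}]$, $g \in G$. For subgroups $A,B$ of a group, $[A,B]$ denotes the subgroup generated by the commutators $[a,b]$ with $a\in A$, $b\in B$, and $[A,B,C]=[[A,B],C]$. Inside $\chi(G)$, where $G$ and $G^{\varphi}$ denote the images of the two factors, put $$L(G)=\langle g^{-1}g^{\varphi} \mid g\in G\rangle,\quad L_1(G)=[L(G),G],\quad L_2(G)=[L(G),G^{\varphi}],$$ $$L_{1,2}(G)=[L_1(G),L_2(G)],\quad R(G)=[G,L(G),G^{\varphi}].$$ (a) For every group $G$, $L_{1,2}(G)\le R(G)$. (b) There is a function $f:\mathbb{N}\to\mathbb{N}$ such that for every $d \in \mathbb{N}$ and every group $G$ for which both $G$ and its derived subgroup $G'$ can be generated by at most $d$ elements, $L_{1,2}(G)$ is finitely generated and has rank at most $f(d)$, i.e. every finitely generated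 subgroup of $L_{1,2}(G)$ (in particular $L_{1,2}(G)$ itself) can be generated by at most $f(d)$ elements. -/

import Mathlib

universe u

namespace WeakComm

open scoped commutatorElement

/-- `H` is `n`-generated: it can be generated by at most `n` elements. -/
def IsGenBy {K : Type u} [Group K] (n : ℕ) (H : Subgroup K) : Prop :=
  ∃ S : Finset K, S.card ≤ n ∧ Subgroup.closure (S : Set K) = H

/-- The subgroup `H` has (Prüfer) rank at most `r`: every finitely generated subgroup of `H`
can be generated by at most `r` elements. -/
def RankLE {K : Type u} [Group K] (r : ℕ) (H : Subgroup K) : Prop :=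
  ∀ B : Subgroup K, B ≤ H → B.FG → IsGenBy r B

/-- The normal closure, in the free product `G * G^φ`, of the relators `[g, g^φ]`, `g ∈ G`.
The second free factor plays the role of the isomorphic copy `G^φ`. -/
def relators (G : Type u) [Group G] : Subgroup (Monoid.Coprod G G) :=
  Subgroup.normalClosure
    (Set.range fun g : G => ⁅(Monoid.Coprod.inl g : Monoid.Coprod G G), Monoid.Coprod.inr g⁆)

instance (G : Type u) [Group G] : (relators G).Normal :=
  Subgroup.normalClosure_normal

/-- The weak commutativity group `χ(G) = ⟨G ∪ G^φ ∣ [g, g^φ] = 1 for all g ∈ G⟩`. -/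
abbrev Chi (G : Type u) [Group G] : Type u :=
  Monoid.Coprod G G ⧸ relators G

/-- The natural map `G → χ(G)`, `g ↦ g`. -/
def ι (G : Type u) [Group G] : G →* Chi G :=
  (QuotientGroup.mk' (relators G)).comp Monoid.Coprod.inl

/-- The natural map `G → χ(G)`, `g ↦ g^φ`. -/
def ιφ (G : Type u) [Group G] : G →* Chi G :=
  (QuotientGroup.mk' (relators G)).comp Monoid.Coprod.inr

/-- `L(G) = ⟨g⁻¹ g^φ ∣ g ∈ G⟩`. -/
def L (G : Type u) [Group G] : Subgroup (Chi G) :=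
  Subgroup.closure (Set.range fun g : G => (ι G g)⁻¹ * ιφ G g)

/-- `L₁(G) = [L(G), G]`. -/
def L₁ (G : Type u) [Group G] : Subgroup (Chi G) :=
  ⁅L G, (ι G).range⁆

/-- `L₂(G) = [L(G), G^φ]`. -/
def L₂ (G : Type u) [Group G] : Subgroup (Chi G) :=
  ⁅L G, (ιφ G).range⁆

/-- `L₁,₂(G) = [L₁(G), L₂(G)]`. -/
def L₁₂ (G : Type u) [Group G] : Subgroup (Chi G) :=
  ⁅L₁ G, L₂ G⁆

/-- `R(G) = [G, L(G), G^φ] = [[G, L(G)], G^φ]`. -/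
def R (G : Type u) [Group G] : Subgroup (Chi G) :=
  ⁅⁅(ι G).range, L G⁆, (ιφ G).range⁆

end WeakComm

namespace WeakComm

open scoped commutatorElement

/-! ### Finite generation, rank and commutator subgroups in arbitrary groups. -/

section General

variable {K : Type u} [Group K]

/-! Part (a) is the three subgroups lemma modulo the normal subgroup `R G`. For (b), put `D = [G,
G^φ]`. The defining relations force `[g, h^φ] = [g^φ, h]`, and hence `D` and `L` centralize each
other. Modulo `D` the two copies of `G` commute, so there `L₁` and `L₂` become the images of the two
copies of `G'`, and each is generated by `d` elements. Lift these generators: since `D` centralizes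
`L`, only the `d * d` commutators of lifts with lifts survive. They lie in `L₁₂ ≤ R ≤ D ∩ L`, so
they are centralized by `L₁` and `L₂` and generate `L₁₂`. The same inclusions make `L₁₂` abelian, so
its rank is at most `d * d`. -/

theorem IsGenBy.fg {n : ℕ} {H : Subgroup K} (h : IsGenBy n H) : H.FG :=
  let ⟨S, _, hS⟩ := h
  ⟨S, hS⟩

theorem IsGenBy.map {K' : Type u} [Group K'] {n : ℕ} {H : Subgroup K} (h : IsGenBy n H)
    (f : K →* K') : IsGenBy n (H.map f) := by
  classical
  obtain ⟨S, hc, rfl⟩ := h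
  exact ⟨S.image f, Finset.card_image_le.trans hc, by simp [MonoidHom.map_closure]⟩

/-- A generating set of the image of `H` lifts to a subset of `H` of no larger size. -/
theorem exists_lift_of_isGenBy_map {K' : Type u} [Group K'] {n : ℕ} (f : K →* K')
    (H : Subgroup K) (h : IsGenBy n (H.map f)) :
    ∃ S : Finset K, S.card ≤ n ∧ (S : Set K) ⊆ H ∧
      H ≤ Subgroup.closure ((S : Set K) ∪ ((H ⊓ f.ker : Subgroup K) : Set K)) := by
  classical
  obtain ⟨T, hc, hT⟩ := h
  have hlift : ∀ t ∈ T, ∃ x ∈ H, f x = t := fun t ht => by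
    have : t ∈ H.map f := hT ▸ Subgroup.subset_closure ht
    simpa using this
  choose! s hsH hs using hlift
  have hsub : ((T.image s : Finset K) : Set K) ⊆ H := by
    intro x hx
    obtain ⟨t, ht, rfl⟩ := Finset.mem_image.1 (Finset.mem_coe.1 hx)
    exact hsH t ht
  refine ⟨T.image s, Finset.card_image_le.trans hc, hsub, fun x hx => ?_⟩
  have himage : f '' ((T.image s : Finset K) : Set K) = T := by
    ext t
    constructor
    · rintro ⟨_, hx, rfl⟩
      obtain ⟨t, ht, rfl⟩ := Finset.mem_image.1 (Finset.mem_coe.1 hx)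
      rw [hs t ht]; exact ht
    · exact fun ht => ⟨s t, Finset.mem_coe.2 (Finset.mem_image_of_mem s ht), hs t ht⟩
  have hfx : f x ∈ (Subgroup.closure ((T.image s : Finset K) : Set K)).map f := by
    rw [MonoidHom.map_closure, himage, hT]
    exact Subgroup.mem_map_of_mem f hx
  obtain ⟨y, hy, hyx⟩ := hfx
  have hyH : y ∈ H := (Subgroup.closure_le H).2 hsub hy
  have hker : y⁻¹ * x ∈ H ⊓ f.ker :=
    ⟨H.mul_mem (H.inv_mem hyH) hx, by simp [hyx]⟩
  rw [← mul_inv_cancel_left y x]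
  exact Subgroup.mul_mem _ (Subgroup.closure_mono Set.subset_union_left hy)
    (Subgroup.subset_closure (Or.inr hker))

/-- If the commutators of the elements of `A` with those of `B` lie in a subgroup `N` centralized
by `A` and by `B`, then `N` contains the commutator of the subgroups generated by `A` and `B`. -/
theorem commutator_closure_le {A B : Set K} {N : Subgroup K}
    (hN : ∀ a ∈ A, ∀ b ∈ B, ⁅a, b⁆ ∈ N)
    (hA : N ≤ Subgroup.centralizer A) (hB : N ≤ Subgroup.centralizer B) :
    ⁅Subgroup.closure A, Subgroup.closure B⁆ ≤ N := by
  have hcentral : ∀ {C : Set K}, N ≤ Subgroup.centralizer C →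
      ∀ x ∈ Subgroup.closure C, ∀ n ∈ N, x * n * x⁻¹ = n := by
    intro C hC x hx n hn
    have hx' : x ∈ Subgroup.centralizer (N : Set K) :=
      (Subgroup.closure_le _).2 (fun c hc => Subgroup.mem_centralizer_iff.2 fun m hm =>
        (Subgroup.mem_centralizer_iff.1 (hC hm) c hc).symm) hx
    rw [← Subgroup.mem_centralizer_iff.1 hx' n hn, mul_inv_cancel_right]
  have hleft : ∀ x ∈ Subgroup.closure A, ∀ b ∈ B, ⁅x, b⁆ ∈ N := by
    intro x hx b hb
    induction hx using Subgroup.closure_induction with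
    | mem a ha => exact hN a ha b hb
    | one => simp
    | mul x y hx hy ihx ihy =>
      rw [commutatorElement_mul_left_eq_conj_mul, hcentral hA x hx _ ihy]
      exact N.mul_mem ihy ihx
    | inv x hx ih =>
      have h := hcentral hA _ (Subgroup.inv_mem _ hx) _ (N.inv_mem ih)
      rw [commutatorElement_inv, inv_inv] at h
      rw [commutatorElement_inv_left, h, ← commutatorElement_inv]
      exact N.inv_mem ih
  rw [Subgroup.commutator_le]
  intro x hx y hy
  induction hy using Subgroup.closure_induction with
  | mem b hb => exact hleft x hx b hb
  | one => simp
  | mul y z hy hz ihy ihz =>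
    rw [commutatorElement_mul_right_eq_mul_conj, mul_assoc, mul_assoc, ← mul_assoc y,
      hcentral hB y hy _ ihz]
    exact N.mul_mem ihy ihz
  | inv y hy ih =>
    have h := hcentral hB _ (Subgroup.inv_mem _ hy) _ (N.inv_mem ih)
    rw [commutatorElement_inv, inv_inv] at h
    rw [commutatorElement_inv_right, h, ← commutatorElement_inv]
    exact N.inv_mem ih

/-- The generators give a surjection from a free abelian group of rank at most `n`. The preimage of
`B` is free of no larger rank, and the image of its basis generates `B`. -/
theorem IsGenBy.of_top {M : Type u} [Group M] [IsMulCommutative M] {n : ℕ}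
    (h : IsGenBy n (⊤ : Subgroup M)) (B : Subgroup M) : IsGenBy n B := by
  classical
  let _ : CommGroup M := { ‹Group M› with mul_comm := mul_comm' }
  obtain ⟨S, hc, hS⟩ := h
  let f : (S → ℤ) →ₗ[ℤ] Additive M :=
    Fintype.linearCombination ℤ fun s : S => Additive.ofMul (s : M)
  have hf : ∀ m : M, ∃ v, f v = Additive.ofMul m := by
    intro m
    have hm : m ∈ Subgroup.closure (S : Set M) := hS ▸ Subgroup.mem_top m
    induction hm using Subgroup.closure_induction with
    | mem s hs => exact ⟨Pi.single ⟨s, hs⟩ 1, by simp [f, Fintype.linearCombination_apply_single]⟩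
    | one => exact ⟨0, by simp⟩
    | mul x y _ _ hx hy =>
      obtain ⟨v, hv⟩ := hx
      obtain ⟨w, hw⟩ := hy
      exact ⟨v + w, by rw [map_add, hv, hw, ofMul_mul]⟩
    | inv x _ hx =>
      obtain ⟨v, hv⟩ := hx
      exact ⟨-v, by rw [map_neg, hv, ofMul_inv]⟩
  let P : Submodule ℤ (S → ℤ) := (AddSubgroup.toIntSubmodule B.toAddSubgroup).comap f
  obtain ⟨k, ⟨b⟩⟩ := Submodule.nonempty_basis_of_pid (Pi.basisFun ℤ S) P
  have hk : k ≤ n := by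
    have h1 : Module.finrank ℤ P = k := by simp [Module.finrank_eq_card_basis b]
    have h2 : Module.finrank ℤ (S → ℤ) = S.card := by simp
    have h3 := Submodule.finrank_le P
    omega
  have hBP : ∀ v : P, (f v).toMul ∈ B := fun v => v.2
  refine ⟨Finset.univ.image fun i => (f (b i)).toMul,
    Finset.card_image_le.trans (by simpa using hk), le_antisymm ?_ ?_⟩
  · rw [Subgroup.closure_le]
    intro x hx
    obtain ⟨i, -, rfl⟩ := Finset.mem_image.1 (Finset.mem_coe.1 hx)
    exact hBP (b i)
  · intro x hx
    obtain ⟨v, hv⟩ := hf x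
    have hvP : v ∈ P := by
      change (f v).toMul ∈ B
      rw [hv]; exact hx
    have hx' : x = (f ((⟨v, hvP⟩ : P) : S → ℤ)).toMul := by simp [hv]
    rw [hx', ← b.sum_repr ⟨v, hvP⟩, Submodule.coe_sum, map_sum, toMul_sum]
    refine Subgroup.prod_mem _ fun i _ => ?_
    rw [Submodule.coe_smul, map_smul, toMul_zsmul]
    exact Subgroup.zpow_mem _ (Subgroup.subset_closure (by simp)) _

/-- An abelian subgroup generated by `n` elements has rank at most `n`. -/
theorem IsGenBy.rankLE {n : ℕ} {H : Subgroup K} [IsMulCommutative H] (h : IsGenBy n H) :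
    RankLE n H := by
  classical
  intro B hB _
  have htop : IsGenBy n (⊤ : Subgroup H) := by
    obtain ⟨S, hc, hS⟩ := h
    have hSH : (S : Set K) ⊆ H := hS ▸ Subgroup.subset_closure
    refine ⟨S.subtype (· ∈ H), (Finset.card_subtype _ S).trans_le
      ((Finset.card_filter_le _ _).trans hc), ?_⟩
    apply Subgroup.map_injective H.subtype_injective
    rw [MonoidHom.map_closure, ← MonoidHom.range_eq_map, Subgroup.range_subtype]
    conv_rhs => rw [← hS]
    congr 1
    ext x
    simpa using fun hx => hSH hx
  have hB' : IsGenBy n (B.subgroupOf H) := htop.of_top _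
  have := hB'.map H.subtype
  rwa [Subgroup.map_subgroupOf_eq_of_le hB] at this

/-- Let `K` be generated by the images of two homomorphisms `i`, `j` that commute modulo `D`.
If `U` contains the elements `i g * (j g)⁻¹`, then `[U, i(G)]` agrees with `i(G')` modulo `D`. -/
theorem map_commutator_range {G : Type u} [Group G] (i j : G →* K) (D : Subgroup K) [D.Normal]
    (hD : ∀ a b, ⁅i a, j b⁆ ∈ D) (hgen : i.range ⊔ j.range = ⊤)
    (U : Subgroup K) (hU : ∀ g, i g * (j g)⁻¹ ∈ U) :
    ⁅U, i.range⁆.map (QuotientGroup.mk' D) =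
      (commutator G).map ((QuotientGroup.mk' D).comp i) := by
  set π := QuotientGroup.mk' D
  have hcomm : ∀ a b, Commute (π (i a)) (π (j b)) := fun a b => by
    rw [← commutatorElement_eq_one_iff_commute, ← map_commutatorElement]
    exact (QuotientGroup.eq_one_iff _).2 (hD a b)
  have hfactor : ∀ x : K, ∃ a b, π x = π (i a) * π (j b) := by
    intro x
    have hx : x ∈ i.range ⊔ j.range := hgen ▸ Subgroup.mem_top x
    rw [Subgroup.sup_eq_closure] at hx
    induction hx using Subgroup.closure_induction with
    | mem x hx =>
      rcases hx with ⟨a, rfl⟩ | ⟨b, rfl⟩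
      · exact ⟨a, 1, by simp⟩
      · exact ⟨1, b, by simp⟩
    | one => exact ⟨1, 1, by simp⟩
    | mul x y _ _ hx hy =>
      obtain ⟨a, b, h⟩ := hx
      obtain ⟨c, d, h'⟩ := hy
      exact ⟨a * c, b * d, by
        simp only [map_mul, h, h']
        exact (hcomm c b).symm.mul_mul_mul_comm _ _⟩
    | inv x _ hx =>
      obtain ⟨a, b, h⟩ := hx
      exact ⟨a⁻¹, b⁻¹, by
        simp only [map_inv, h, mul_inv_rev]
        exact ((hcomm a b).inv_inv).eq.symm⟩
  have hcalc : ∀ x a b g, π x = π (i a) * π (j b) → π ⁅x, i g⁆ = π (i ⁅a, g⁆) := by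
    intro x a b g h
    rw [map_commutatorElement, h, commutatorElement_mul_left_eq_conj_mul,
      ((hcomm g b).symm).commutator_eq]
    simp [map_commutatorElement]
  apply le_antisymm
  · rw [Subgroup.map_le_iff_le_comap, Subgroup.commutator_le]
    rintro x hx _ ⟨g, rfl⟩
    obtain ⟨a, b, h⟩ := hfactor x
    exact ⟨⁅a, g⁆, Subgroup.commutator_mem_commutator (Subgroup.mem_top _) (Subgroup.mem_top _),
      (hcalc x a b g h).symm⟩
  -- The factor `(j a)⁻¹` commutes with `i g` modulo `D`, so `i a * (j a)⁻¹ ∈ U` realizes the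
  -- commutator `⁅a, g⁆`.
  · rw [commutator_def, Subgroup.map_le_iff_le_comap, Subgroup.commutator_le]
    intro a _ g _
    exact ⟨⁅i a * (j a)⁻¹, i g⁆, Subgroup.commutator_mem_commutator (hU a) ⟨g, rfl⟩,
      hcalc _ a a⁻¹ g (by simp)⟩

end General

/-! ### The subgroups `D` and `L` of `χ(G)`. -/

section Chi

variable (G : Type u) [Group G]

/-- `D(G) = [G, G^φ]`. -/
def D : Subgroup (Chi G) :=
  ⁅(ι G).range, (ιφ G).range⁆

theorem range_sup_range : (ι G).range ⊔ (ιφ G).range = ⊤ := by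
  rw [ι, ιφ, MonoidHom.range_comp, MonoidHom.range_comp, ← Subgroup.map_sup,
    Monoid.Coprod.range_inl_sup_range_inr, ← MonoidHom.range_eq_map]
  exact MonoidHom.range_eq_top.2 (QuotientGroup.mk'_surjective _)

theorem commute_ι_ιφ (g : G) : Commute (ι G g) (ιφ G g) := by
  rw [← commutatorElement_eq_one_iff_commute]
  have : (QuotientGroup.mk' (relators G)) ⁅Monoid.Coprod.inl g, Monoid.Coprod.inr g⁆ = 1 :=
    (QuotientGroup.eq_one_iff _).2 (Subgroup.subset_normalClosure ⟨g, rfl⟩)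
  rwa [map_commutatorElement] at this

/-- A subgroup of `χ(G)` normalized by `G` and `G^φ` is normal. -/
theorem normal_of_range_le_normalizer {H : Subgroup (Chi G)}
    (h : (ι G).range ≤ Subgroup.normalizer (H : Set (Chi G)))
    (h' : (ιφ G).range ≤ Subgroup.normalizer (H : Set (Chi G))) : H.Normal := by
  rw [← Subgroup.normalizer_eq_top_iff, eq_top_iff, ← range_sup_range G]
  exact sup_le h h'

instance : (D G).Normal :=
  normal_of_range_le_normalizer G (Subgroup.normalizer_commutator_ge_left _ _)
    (Subgroup.normalizer_commutator_ge_right _ _)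

theorem mul_inv_mem_L (g : G) : ι G g * (ιφ G g)⁻¹ ∈ L G :=
  Subgroup.subset_closure ⟨g⁻¹, by simp⟩

theorem mul_inv_mem_L' (g : G) : ιφ G g * (ι G g)⁻¹ ∈ L G := by
  simpa using (L G).inv_mem (mul_inv_mem_L G g)

/-- The relations `[g, h^φ] = [g^φ, h]`. -/
theorem commutator_ι_ιφ (g h : G) : ⁅ι G g, ιφ G h⁆ = ⁅ιφ G g, ι G h⁆ := by
  have key : ∀ g h : G, ⁅(ι G g)⁻¹, ιφ G h⁆ = ⁅(ιφ G g)⁻¹, ι G h⁆ := by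
    intro g h
    have h1 := (commute_ι_ιφ G g).eq
    have h2 := (commute_ι_ιφ G h).eq
    have h3 := (commute_ι_ιφ G (g * h)).eq
    simp only [map_mul] at h3
    generalize ι G g = a at *
    generalize ιφ G g = b at *
    generalize ι G h = c at *
    generalize ιφ G h = d at *
    -- This is the relation that `g * h` commutes with its copy, rearranged using that `a` and `b`
    -- commute.
    have h4 : a * (b⁻¹ * c * b) * d = d * a * c := by
      have h5 : b⁻¹ * a = a * b⁻¹ := (Commute.inv_left (show Commute b a from h1.symm)).eq
      calc a * (b⁻¹ * c * b) * d = (a * b⁻¹) * c * b * d := by group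
        _ = b⁻¹ * (a * c * (b * d)) := by rw [← h5]; group
        _ = d * a * c := by rw [h3]; group
    simp only [commutatorElement_def, inv_inv]
    calc a⁻¹ * d * a * d⁻¹ = a⁻¹ * (d * a * c) * (c⁻¹ * d⁻¹) := by group
      _ = (b⁻¹ * c * b) * (d * (c⁻¹ * d⁻¹)) := by rw [← h4]; group
      _ = b⁻¹ * c * b * c⁻¹ := by
        have : d * (c⁻¹ * d⁻¹) = c⁻¹ := by rw [← mul_inv_rev, ← h2]; group
        rw [this]
  simpa using key g⁻¹ h

/-- `D(G)` and `L(G)` centralize each other. -/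
theorem L_le_centralizer_D : L G ≤ Subgroup.centralizer (D G : Set (Chi G)) := by
  -- Expand `[kg, h^φ] = [k^φ g^φ, h]` on both sides and cancel `[k, h^φ] = [k^φ, h]`: conjugation
  -- by `k` and by `k^φ` agree on the generators of `D`.
  have hconj : ∀ k g h : G, ι G k * ⁅ι G g, ιφ G h⁆ * (ι G k)⁻¹ =
      ιφ G k * ⁅ι G g, ιφ G h⁆ * (ιφ G k)⁻¹ := by
    intro k g h
    have h1 := commutator_ι_ιφ G (k * g) h
    simp only [map_mul, commutatorElement_mul_left_eq_conj_mul] at h1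
    rw [← commutator_ι_ιφ G k h, ← commutator_ι_ιφ G g h] at h1
    exact mul_right_cancel h1
  rw [L, Subgroup.closure_le]
  rintro _ ⟨k, rfl⟩
  have : D G ≤ Subgroup.centralizer {(ι G k)⁻¹ * ιφ G k} := by
    rw [D, Subgroup.commutator_le]
    rintro _ ⟨g, rfl⟩ _ ⟨h, rfl⟩
    rw [Subgroup.mem_centralizer_singleton_iff]
    have := hconj k g h
    generalize ⁅ι G g, ιφ G h⁆ = c at *
    calc c * ((ι G k)⁻¹ * ιφ G k)
        = (ι G k)⁻¹ * (ι G k * c * (ι G k)⁻¹) * ιφ G k := by group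
      _ = (ι G k)⁻¹ * ιφ G k * c := by rw [this]; group
  refine Subgroup.mem_centralizer_iff.2 fun c hc => ?_
  exact Subgroup.mem_centralizer_singleton_iff.1 (this hc)

instance : (L G).Normal := by
  have hι : ∀ h : G, ∀ x ∈ L G, ι G h * x * (ι G h)⁻¹ ∈ L G := by
    intro h x hx
    have : L G ≤ (L G).comap (MulAut.conj (ι G h)).toMonoidHom := by
      conv_lhs => rw [L]
      rw [Subgroup.closure_le]
      rintro _ ⟨g, rfl⟩
      have h1 : (ι G (g * h⁻¹))⁻¹ * ιφ G (g * h⁻¹) ∈ L G := Subgroup.subset_closure ⟨_, rfl⟩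
      have h2 : (ι G h⁻¹)⁻¹ * ιφ G h⁻¹ ∈ L G := Subgroup.subset_closure ⟨_, rfl⟩
      -- Conjugating the generator of `g` by `h` gives the generator of `g * h⁻¹` times the inverse
      -- of the generator of `h⁻¹`.
      have h3 := (L G).mul_mem h1 ((L G).inv_mem h2)
      have h4 : ι G h * ((ι G g)⁻¹ * ιφ G g) * (ι G h)⁻¹ ∈ L G := by
        convert h3 using 1
        simp only [map_mul, map_inv]
        group
      exact h4
    exact this hx
  refine normal_of_range_le_normalizer G ?_ ?_
  · rintro _ ⟨h, rfl⟩
    refine Subgroup.mem_normalizer_iff.2 fun x => ⟨hι h x, fun hx => ?_⟩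
    simpa [mul_assoc] using hι h⁻¹ _ hx
  · rintro _ ⟨h, rfl⟩
    have h1 : ι G h ∈ Subgroup.normalizer (L G : Set (Chi G)) := by
      refine Subgroup.mem_normalizer_iff.2 fun x => ⟨hι h x, fun hx => ?_⟩
      simpa [mul_assoc] using hι h⁻¹ _ hx
    have h2 : (ι G h)⁻¹ * ιφ G h ∈ Subgroup.normalizer (L G : Set (Chi G)) :=
      Subgroup.le_normalizer (Subgroup.subset_closure ⟨h, rfl⟩)
    simpa using Subgroup.mul_mem _ h1 h2

theorem range_ι_sup_L : (ι G).range ⊔ L G = ⊤ := by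
  rw [eq_top_iff, ← range_sup_range G]
  refine sup_le le_sup_left ?_
  rintro _ ⟨g, rfl⟩
  rw [← mul_inv_cancel_left (ι G g) (ιφ G g)]
  exact Subgroup.mul_mem_sup ⟨g, rfl⟩ (Subgroup.subset_closure ⟨g, rfl⟩)

theorem range_ιφ_sup_L : (ιφ G).range ⊔ L G = ⊤ := by
  rw [eq_top_iff, ← range_sup_range G]
  refine sup_le ?_ le_sup_left
  rintro _ ⟨g, rfl⟩
  have h : (ι G g)⁻¹ * ιφ G g ∈ L G := Subgroup.subset_closure ⟨g, rfl⟩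
  have h' : ι G g = ιφ G g * ((ι G g)⁻¹ * ιφ G g)⁻¹ := by group
  rw [h']
  exact Subgroup.mul_mem_sup ⟨g, rfl⟩ ((L G).inv_mem h)

/-! ### The subgroups `L₁`, `L₂`, `R` and `L₁₂`. -/

instance : (L₁ G).Normal := by
  rw [← Subgroup.normalizer_eq_top_iff, eq_top_iff, ← range_ι_sup_L G]
  exact sup_le (Subgroup.normalizer_commutator_ge_right _ _)
    (Subgroup.normalizer_commutator_ge_left _ _)

theorem L₁_le_L : L₁ G ≤ L G := Subgroup.commutator_le_left _ _

theorem L₂_le_L : L₂ G ≤ L G := Subgroup.commutator_le_left _ _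

theorem R_eq : R G = ⁅L₁ G, (ιφ G).range⁆ := by
  rw [R, L₁, Subgroup.commutator_comm (ι G).range]

theorem R_le_L : R G ≤ L G := by
  rw [R_eq]
  exact (Subgroup.commutator_le_left _ _).trans (L₁_le_L G)

theorem commutator_mem_D (a b : G) : ⁅ι G a, ιφ G b⁆ ∈ D G :=
  Subgroup.commutator_mem_commutator ⟨a, rfl⟩ ⟨b, rfl⟩

theorem commutator_mem_D' (a b : G) : ⁅ιφ G a, ι G b⁆ ∈ D G :=
  commutator_ι_ιφ G a b ▸ commutator_mem_D G a b

theorem map_L₁ : (L₁ G).map (QuotientGroup.mk' (D G)) =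
    (commutator G).map ((QuotientGroup.mk' (D G)).comp (ι G)) :=
  map_commutator_range (ι G) (ιφ G) (D G) (commutator_mem_D G) (range_sup_range G) (L G)
    (mul_inv_mem_L G)

theorem map_L₂ : (L₂ G).map (QuotientGroup.mk' (D G)) =
    (commutator G).map ((QuotientGroup.mk' (D G)).comp (ιφ G)) :=
  map_commutator_range (ιφ G) (ι G) (D G) (commutator_mem_D' G)
    (sup_comm (ι G).range _ ▸ range_sup_range G) (L G) (mul_inv_mem_L' G)

/-- Modulo `D`, `L₁` lies in the image of `G`, which commutes with that of `G^φ`. -/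
theorem R_le_D : R G ≤ D G := by
  rw [R_eq, Subgroup.commutator_le]
  rintro x hx _ ⟨b, rfl⟩
  have hx' := Subgroup.mem_map_of_mem (QuotientGroup.mk' (D G)) hx
  rw [map_L₁] at hx'
  obtain ⟨a, -, ha⟩ := hx'
  rw [← QuotientGroup.eq_one_iff, ← QuotientGroup.mk'_apply, map_commutatorElement, ← ha,
    MonoidHom.comp_apply, ← map_commutatorElement]
  exact (QuotientGroup.eq_one_iff _).2 (commutator_mem_D G a b)

theorem D_le_centralizer_L : D G ≤ Subgroup.centralizer (L G : Set (Chi G)) :=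
  Subgroup.le_centralizer_iff.1 (L_le_centralizer_D G)

/-- `G^φ` normalizes `[L₁, G^φ]`, `L` centralizes it because `R ≤ D`, and together they generate
`χ(G)`. -/
instance : (R G).Normal := by
  rw [← Subgroup.normalizer_eq_top_iff, eq_top_iff, ← range_ιφ_sup_L G]
  refine sup_le (Subgroup.normalizer_commutator_ge_right _ _) ?_
  rw [Subgroup.le_normalizer_iff_commutator_le_right,
    Subgroup.commutator_eq_bot_iff_le_centralizer.2]
  · exact bot_le
  · exact (L_le_centralizer_D G).trans (Subgroup.centralizer_le (R_le_D G))

theorem L₁₂_le_R : L₁₂ G ≤ R G := by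
  set π := QuotientGroup.mk' (R G)
  have hbot : ∀ H : Subgroup (Chi G), H ≤ R G ↔ H.map π = ⊥ := fun H => by
    rw [Subgroup.map_eq_bot_iff, QuotientGroup.ker_mk']
  have hR : ⁅(L₁ G).map π, (ιφ G).range.map π⁆ = ⊥ := by
    rw [← Subgroup.map_commutator, ← hbot, R_eq]
  rw [hbot, L₁₂, L₂, Subgroup.map_commutator, Subgroup.map_commutator, Subgroup.commutator_comm]
  -- Three subgroups lemma for `L`, `G^φ`, `L₁`: modulo `R`, `[[G^φ, L₁], L]` vanishes by
  -- definition, and `[[L₁, L], G^φ]` because `L₁` is normal.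
  apply Subgroup.commutator_commutator_eq_bot_of_rotate
  · rw [Subgroup.commutator_comm (Subgroup.map π (ιφ G).range), hR, Subgroup.commutator_bot_left]
  · rw [eq_bot_iff, ← hR]
    refine Subgroup.commutator_mono ?_ le_rfl
    rw [← Subgroup.map_commutator]
    exact Subgroup.map_mono (Subgroup.commutator_le_left _ _)

theorem L₁₂_le_centralizer_L : L₁₂ G ≤ Subgroup.centralizer (L G : Set (Chi G)) :=
  (L₁₂_le_R G).trans ((R_le_D G).trans (D_le_centralizer_L G))

instance : IsMulCommutative (L₁₂ G) := by
  rw [← Subgroup.le_centralizer_iff_isMulCommutative]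
  exact (L₁₂_le_centralizer_L G).trans
    (Subgroup.centralizer_le ((L₁₂_le_R G).trans (R_le_L G)))

/-- If `G'` is generated by `d` elements, then `L₁,₂(G)` is generated by `d²` elements. -/
theorem isGenBy_L₁₂ {d : ℕ} (h : IsGenBy d (commutator G)) : IsGenBy (d * d) (L₁₂ G) := by
  classical
  obtain ⟨S, hSc, hS, hLS⟩ :=
    exists_lift_of_isGenBy_map (QuotientGroup.mk' (D G)) (L₁ G) (map_L₁ G ▸ h.map _)
  obtain ⟨T, hTc, hT, hLT⟩ :=
    exists_lift_of_isGenBy_map (QuotientGroup.mk' (D G)) (L₂ G) (map_L₂ G ▸ h.map _)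
  rw [QuotientGroup.ker_mk'] at hLS hLT
  have hSL : (S : Set (Chi G)) ∪ ((L₁ G ⊓ D G : Subgroup (Chi G)) : Set (Chi G)) ⊆ L G :=
    Set.union_subset (hS.trans (L₁_le_L G)) fun x hx => L₁_le_L G hx.1
  have hTL : (T : Set (Chi G)) ∪ ((L₂ G ⊓ D G : Subgroup (Chi G)) : Set (Chi G)) ⊆ L G :=
    Set.union_subset (hT.trans (L₂_le_L G)) fun x hx => L₂_le_L G hx.1
  let C : Finset (Chi G) := Finset.image₂ (fun x y => ⁅x, y⁆) S T
  have hle : Subgroup.closure (C : Set (Chi G)) ≤ L₁₂ G := by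
    rw [Subgroup.closure_le]
    intro c hc
    obtain ⟨x, hx, y, hy, rfl⟩ := Finset.mem_image₂.1 (Finset.mem_coe.1 hc)
    exact Subgroup.commutator_mem_commutator (hS hx) (hT hy)
  have hcentral := hle.trans (L₁₂_le_centralizer_L G)
  refine ⟨C, (Finset.card_image₂_le _ _ _).trans (Nat.mul_le_mul hSc hTc), le_antisymm hle ?_⟩
  refine (Subgroup.commutator_mono hLS hLT).trans (commutator_closure_le ?_
    (hcentral.trans (Subgroup.centralizer_le hSL)) (hcentral.trans (Subgroup.centralizer_le hTL)))
  intro x hx y hy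
  -- All the generators lie in `L`, so a commutator with an entry in `D` is trivial.
  by_cases hxD : x ∈ D G
  · rw [commutatorElement_eq_one_iff_mul_comm.2
      (Subgroup.mem_centralizer_iff.1 (D_le_centralizer_L G hxD) y (hTL hy)).symm]
    exact one_mem _
  by_cases hyD : y ∈ D G
  · rw [commutatorElement_eq_one_iff_mul_comm.2
      (Subgroup.mem_centralizer_iff.1 (D_le_centralizer_L G hyD) x (hSL hx))]
    exact one_mem _
  have hxS : x ∈ S := hx.resolve_right fun h => hxD h.2
  have hyT : y ∈ T := hy.resolve_right fun h => hyD h.2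
  exact Subgroup.subset_closure (Finset.mem_coe.2 (Finset.mem_image₂_of_mem hxS hyT))

end Chi

end WeakComm

theorem mainTheorem8 :
    (∀ (G : Type u) [Group G], WeakComm.L₁₂ G ≤ WeakComm.R G) ∧
    ∃ f : ℕ → ℕ, ∀ (d : ℕ) (G : Type u) [Group G],
      WeakComm.IsGenBy d (⊤ : Subgroup G) → WeakComm.IsGenBy d (commutator G) →
        (WeakComm.L₁₂ G).FG ∧ WeakComm.RankLE (f d) (WeakComm.L₁₂ G) := by
  refine ⟨fun G _ => WeakComm.L₁₂_le_R G, fun d => d * d, fun d G _ _ h => ?_⟩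
  have hL := WeakComm.isGenBy_L₁₂ G h
  exact ⟨hL.fg, hL.rankLE⟩
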